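/- A mixed graph $\mathcal G$ on a finite vertex set $\mathbf V$ has directed edges $X\to Y$ and bidirected edges $X\leftrightarrow Y$; two distinct vertices joined by an edge are neighbors, and $\mathrm{Ne}(X)$ denotes the set of neighbors of $X$. Paths have no repeated vertices. A vertex $X$ is an ancestor of $Y$ if there is a directed path $X\to\dots\to Y$ (each vertex is an ancestor of itself), and $\mathrm{Anc}(\mathbf S)$ is the set of ancestors of members of $\mathbf S$. A non-endpoint vertex of a path is a collider on it if both adjacent edges of the path have an arrowhead at it. A collider path is a path all of whose non-endpoint vertices are colliders, and the Markov boundary $\mathrm{Mb}(X)$ is the set of vertices other than $X$ that have a collider path to $X$ (so $\mathrm{Ne}(X)\subseteq\mathrm{Mb}(X)$). For distinct $X,Y$ and $\mathbf Z\subseteq\mathbf V\setminus\{X,Y\}$, we say that $\mathbf Z$ m-separates $X$ and $Y$ in $\mathcal G$, written $(X\perp Y\mid\mathbf Z)_{\mathcal G}$, if every path between $X$ and $Y$ contains a non-endpoint vertex that is either a collider on the path and not in $\mathrm{Anc}(\mathbf Z\cup\{X,Y\})$, or a non-collider on the path and in $\mathbf Z$; otherwise $X$ and $Y$ are m-connected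 given $\mathbf Z$. The graph $\mathcal G$ is a maximal ancestral graph (MAG) if there are no $X,Y$ with $Y$ an ancestor of $X$ and $X\to Y$ or $X\leftrightarrow Y$, and every two distinct non-neighbors $X,Y$ are m-separated by some subset of $\mathbf V\setminus\{X,Y\}$. A vertex $X$ of a MAG $\mathcal G$ is removable if, for all distinct $Y,T\in\mathbf V\setminus\{X\}$ and all $\mathbf Z\subseteq\mathbf V\setminus\{X,Y,T\}$, $(Y\perp T\mid\mathbf Z)_{\mathcal G}$ holds if and only if $(Y\perp T\mid\mathbf Z)_{\mathcal G[\mathbf V\setminus\{X\}]}$ holds, where $\mathcal G[\mathbf V\setminus\{X\}]$ is the induced subgraph on $\mathbf V\setminus\{X\}$. **Theorem.** Let $\mathcal G$ be a MAG on a finite vertex set $\mathbf V$ and let $X\in\mathbf V$. Then $X$ is removable in $\mathcal G$ if and only if for every $Y\in\mathrm{Mb}(X)$ and every $Z\in\mathrm{Ne}(X)\setminus\{Y\}$ at least one of the following two conditions holds: 1. there is a set $\mathbf W\subseteq\mathrm{Mb}(X)\setminus\{Y,Z\}$ that m-separates $Y$ and $Z$ in $\mathcal G$; 2. for every set $\mathbf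 W\subseteq\mathrm{Mb}(X)\setminus\{Y,Z\}$, $Y$ and $Z$ are m-connected given $\mathbf W\cup\{X\}$ in $\mathcal G$. -/

import Mathlib

/-- A mixed graph on the vertex type `V`: directed edges `dir X Y` (that is, `X → Y`), and
bidirected edges `bidir X Y` (that is, `X ↔ Y`), which are unordered. -/
structure MixedGraph (V : Type*) where
  dir : V → V → Prop
  bidir : V → V → Prop
  bidir_symm : ∀ X Y : V, bidir X Y → bidir Y X

namespace MixedGraph

/-- The skeleton: distinct vertices are adjacent when some edge joins them. -/
def skeleton {V : Type*} (G : MixedGraph V) : SimpleGraph V where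
  Adj X Y := X ≠ Y ∧ (G.dir X Y ∨ G.dir Y X ∨ G.bidir X Y)
  symm := ⟨fun X Y h => ⟨h.1.symm, by
    rcases h.2 with h | h | h
    · exact Or.inr (Or.inl h)
    · exact Or.inl h
    · exact Or.inr (Or.inr (G.bidir_symm X Y h))⟩⟩
  loopless := ⟨fun X h => h.1 rfl⟩

/-- The set of neighbors of `X`. -/
def Ne {V : Type*} (G : MixedGraph V) (X : V) : Set V := {Y | G.skeleton.Adj X Y}

/-- The subgraph of `G` induced on the vertex set `W`. -/
def induce {V : Type*} (G : MixedGraph V) (W : Set V) : MixedGraph W where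
  dir X Y := G.dir X Y
  bidir X Y := G.bidir X Y
  bidir_symm X Y h := G.bidir_symm X Y h

/-- The set of ancestors of `X`: the vertices with a directed path to `X`, including `X`. -/
def Anc {V : Type*} (G : MixedGraph V) (X : V) : Set V := {Y | Relation.ReflTransGen G.dir Y X}

/-- The set of ancestors of the members of a set of vertices. -/
def AncSet {V : Type*} (G : MixedGraph V) (S : Set V) : Set V := ⋃ X ∈ S, G.Anc X

/-- The edge between `X` and `Y` has an arrowhead at `Y`: `X → Y` or `X ↔ Y`. -/
def Into {V : Type*} (G : MixedGraph V) (X Y : V) : Prop := G.dir X Y ∨ G.bidir X Y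

/-- `B` is a collider between its two neighbors `A` and `C` on a path. -/
def Collider {V : Type*} (G : MixedGraph V) (A B C : V) : Prop := G.Into A B ∧ G.Into C B

/-- `A, B, C` are consecutive vertices of the walk `p`, in this order; in particular `B` is an
interior vertex of `p`. -/
def Consec {V : Type*} {G : MixedGraph V} {X Y : V} (p : G.skeleton.Walk X Y) (A B C : V) :
    Prop := [A, B, C] <:+: p.support

/-- A path (no repeated vertices) all of whose non-endpoint vertices are colliders on it. -/
def IsColliderPath {V : Type*} {G : MixedGraph V} {X Y : V} (p : G.skeleton.Walk X Y) : Prop :=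
  p.IsPath ∧ ∀ A B C : V, Consec p A B C → G.Collider A B C

/-- The path `p` between `X` and `Y` is blocked by `Z`: some non-endpoint vertex of it is either a
collider outside `Anc (Z ∪ {X, Y})` or a non-collider in `Z`. -/
def Blocked {V : Type*} {G : MixedGraph V} {X Y : V} (p : G.skeleton.Walk X Y) (Z : Set V) :
    Prop :=
  ∃ A B C : V, Consec p A B C ∧
    ((G.Collider A B C ∧ B ∉ G.AncSet (Z ∪ {X, Y})) ∨ (¬ G.Collider A B C ∧ B ∈ Z))

/-- `Z` m-separates `X` and `Y`: all paths between them are blocked by `Z`. To be used for distinct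
`X`, `Y` and for `Z` containing neither of them. -/
def MSep {V : Type*} (G : MixedGraph V) (X Y : V) (Z : Set V) : Prop :=
  ∀ p : G.skeleton.Walk X Y, p.IsPath → Blocked p Z

/-- No directed cycles and no almost directed cycles. -/
def IsAncestral {V : Type*} (G : MixedGraph V) : Prop :=
  (¬ ∃ X Y : V, G.dir X Y ∧ Y ∈ G.Anc X) ∧ (¬ ∃ X Y : V, G.bidir X Y ∧ Y ∈ G.Anc X)

/-- Every pair of distinct non-neighbors is m-separated by some set of other vertices. -/
def IsMaximal {V : Type*} (G : MixedGraph V) : Prop :=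
  ∀ X Y : V, X ≠ Y → Y ∉ G.Ne X → ∃ Z : Set V, X ∉ Z ∧ Y ∉ Z ∧ G.MSep X Y Z

/-- Maximal ancestral graphs. -/
def IsMAG {V : Type*} (G : MixedGraph V) : Prop := G.IsAncestral ∧ G.IsMaximal

/-- The Markov boundary of `X`: the other vertices with a collider path to `X`. -/
def Mb {V : Type*} (G : MixedGraph V) (X : V) : Set V :=
  {Y | Y ≠ X ∧ ∃ p : G.skeleton.Walk Y X, IsColliderPath p}

/-- `X` is removable: `G` and its subgraph induced on the vertices other than `X` have the same
m-separations over the vertices other than `X`. -/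
def IsRemovable {V : Type*} (G : MixedGraph V) (X : V) : Prop :=
  ∀ Y T : ({X}ᶜ : Set V), Y ≠ T → ∀ Z : Set ({X}ᶜ : Set V), Y ∉ Z → T ∉ Z →
    (G.MSep (Y : V) (T : V) (Subtype.val '' Z) ↔ (G.induce {X}ᶜ).MSep Y T Z)

end MixedGraph

namespace MixedGraph

variable {V : Type*} {G : MixedGraph V}

/-! Given `Z`, m-connection of `x` and `y` is reachability in `connGraph (AncSet (Z ∪ {x, y})) Z`:
an unblocked path stays among these ancestors, and "no non-collider in `Z`" says edge by edge that
no vertex of `Z` has a tail. Walks can therefore be concatenated freely.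

Both sides of the equivalence are linked through `Shielded`.

If `X` is shielded, ancestry among the other vertices survives its deletion, and a connecting path
through `X` can be rerouted through a last relevant child `W` of `X`: both arms are cut short by
edges into `W`, which becomes a collider (`Shielded.reachable_child`). Hence `X` is removable.

If `X` is not shielded, some child `C` and some `u` violate it. Then `u` and `C` are connected
through `X` given every subset of the boundary, while `X` together with the boundary vertices in
`AncSet {u, C}` separates them by maximality (`IsMAG.not_reachable_mb`). Both conditions fail.

Conversely, if `X` is removable and `W ∪ {X}` separates `Y` and `Z`, then `W` separates them once
`X` is deleted, hence also in `G`. -/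

theorem mem_ancSet {S : Set V} {v : V} :
    v ∈ G.AncSet S ↔ ∃ s ∈ S, Relation.ReflTransGen G.dir v s := by
  simp [AncSet, Anc]

theorem subset_ancSet (S : Set V) : S ⊆ G.AncSet S := fun v hv =>
  mem_ancSet.2 ⟨v, hv, .refl⟩

theorem ancSet_mono {S T : Set V} (h : S ⊆ T) : G.AncSet S ⊆ G.AncSet T :=
  Set.biUnion_subset_biUnion_left h

theorem mem_ancSet_of_dir {S : Set V} {a b : V} (h : G.dir a b) (hb : b ∈ G.AncSet S) :
    a ∈ G.AncSet S := by
  obtain ⟨s, hs, hbs⟩ := mem_ancSet.1 hb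
  exact mem_ancSet.2 ⟨s, hs, .head h hbs⟩

theorem ancSet_subset_ancSet {S T : Set V} (h : S ⊆ G.AncSet T) : G.AncSet S ⊆ G.AncSet T := by
  intro v hv
  obtain ⟨s, hs, hvs⟩ := mem_ancSet.1 hv
  obtain ⟨t, ht, hst⟩ := mem_ancSet.1 (h hs)
  exact mem_ancSet.2 ⟨t, ht, hvs.trans hst⟩

theorem into_or_dir_of_adj {a b : V} (h : G.skeleton.Adj a b) : G.Into a b ∨ G.dir b a := by
  rcases h.2 with h | h | h
  · exact .inl (.inl h)
  · exact .inr h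
  · exact .inl (.inr h)

namespace IsAncestral

variable (hG : G.IsAncestral)
include hG

theorem not_anc_of_into {a b : V} (h : G.Into a b) : ¬ Relation.ReflTransGen G.dir b a := by
  intro hba
  rcases h with h | h
  · exact hG.1 ⟨a, b, h, hba⟩
  · exact hG.2 ⟨a, b, h, hba⟩

theorem not_dir_of_into {a b : V} (h : G.Into a b) : ¬ G.dir b a := fun hd =>
  hG.not_anc_of_into h (.single hd)

theorem adj_of_into {a b : V} (h : G.Into a b) : G.skeleton.Adj a b := by
  refine ⟨fun hab => hG.not_anc_of_into h (hab ▸ .refl), ?_⟩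
  rcases h with h | h
  · exact .inl h
  · exact .inr (.inr h)

theorem bidir_of_into_of_into {a b : V} (h : G.Into a b) (h' : G.Into b a) : G.bidir a b :=
  h.resolve_left (hG.not_dir_of_into h')

end IsAncestral

theorem dir_of_adj_of_anc (hG : G.IsAncestral) {a b : V} (h : G.skeleton.Adj a b)
    (hab : Relation.ReflTransGen G.dir a b) : G.dir a b :=
  (into_or_dir_of_adj h.symm).resolve_left fun h => hG.not_anc_of_into h hab

/-! ### m-connection as reachability -/

/-- The graph whose paths are the paths of `G` inside `S` on which no non-collider is in `N`. -/
def connGraph (G : MixedGraph V) (S N : Set V) : SimpleGraph V where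
  Adj a b := G.skeleton.Adj a b ∧ (a ∈ S ∧ b ∈ S) ∧ (G.dir a b → a ∉ N) ∧ (G.dir b a → b ∉ N)
  symm := ⟨fun _ _ h => ⟨h.1.symm, h.2.1.symm, h.2.2.symm⟩⟩
  loopless := ⟨fun _ h => h.1.ne rfl⟩

theorem connGraph_le {S N : Set V} : G.connGraph S N ≤ G.skeleton := fun _ _ h => h.1

theorem connGraph_adj_of_dir (hG : G.IsAncestral) {S N : Set V} {a b : V} (h : G.dir a b)
    (ha : a ∈ S) (hb : b ∈ S) (hN : a ∉ N) : (G.connGraph S N).Adj a b :=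
  ⟨hG.adj_of_into (.inl h), ⟨ha, hb⟩, fun _ => hN, fun h' => (hG.not_dir_of_into (.inl h) h').elim⟩

theorem connGraph_adj_of_bidir (hG : G.IsAncestral) {S N : Set V} {a b : V} (h : G.bidir a b)
    (ha : a ∈ S) (hb : b ∈ S) : (G.connGraph S N).Adj a b :=
  ⟨hG.adj_of_into (.inr h), ⟨ha, hb⟩,
    fun h' => (hG.not_dir_of_into (.inr (G.bidir_symm _ _ h)) h').elim,
    fun h' => (hG.not_dir_of_into (.inr h) h').elim⟩

theorem connGraph_adj_of_into (hG : G.IsAncestral) {S N : Set V} {a b : V} (h : G.Into a b)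
    (ha : a ∈ S) (hb : b ∈ S) (hN : a ∉ N) : (G.connGraph S N).Adj a b := by
  rcases h with h | h
  · exact connGraph_adj_of_dir hG h ha hb hN
  · exact connGraph_adj_of_bidir hG h ha hb

theorem connGraph_into_of_adj {S N : Set V} {a b : V}
    (h : (G.connGraph S N).Adj a b) (hb : b ∈ N) : G.Into a b :=
  (into_or_dir_of_adj h.1).resolve_right fun hd => h.2.2.2 hd hb

theorem connGraph_reachable_of_bidir_chain (hG : G.IsAncestral) {S N : Set V} {a b : V}
    (ha : a ∈ S) (h : Relation.ReflTransGen (fun u v => G.bidir u v ∧ v ∈ S) a b) :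
    b ∈ S ∧ (G.connGraph S N).Reachable a b := by
  induction h with
  | refl => exact ⟨ha, .refl _⟩
  | tail _ hbc ih =>
    exact ⟨hbc.2, ih.2.trans (connGraph_adj_of_bidir hG hbc.1 ih.1 hbc.2).reachable⟩

theorem exists_isPath_of_reachable {S N : Set V} {x y : V}
    (h : (G.connGraph S N).Reachable x y) :
    ∃ p : G.skeleton.Walk x y, p.IsPath ∧ ∀ A B C, Consec p A B C →
      B ∈ S ∧ (¬ G.Collider A B C → B ∉ N) := by
  obtain ⟨p, hp⟩ := h.exists_isPath
  refine ⟨p.mapLe connGraph_le, hp.mapLe _, fun A B C hc => ?_⟩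
  rw [Consec, SimpleGraph.Walk.support_mapLe_eq_support] at hc
  have hch := p.isChain_adj_support.infix hc
  simp only [List.isChain_cons_cons, List.isChain_singleton, and_true] at hch
  obtain ⟨h1, h2⟩ := hch
  refine ⟨h1.2.1.2, fun hcol hB => hcol ⟨connGraph_into_of_adj h1 hB,
    connGraph_into_of_adj h2.symm hB⟩⟩

theorem not_mSep_of_reachable {x y : V} {Z : Set V}
    (h : (G.connGraph (G.AncSet (Z ∪ {x, y})) Z).Reachable x y) : ¬ G.MSep x y Z := by
  intro hsep
  obtain ⟨p, hp, hpo⟩ := exists_isPath_of_reachable h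
  obtain ⟨A, B, C, hc, ⟨_, h⟩ | ⟨h, hB⟩⟩ := hsep p hp
  · exact h (hpo A B C hc).1
  · exact (hpo A B C hc).2 h hB

/-- Follow the directed edges from `b` along the path until they stop at a collider or at the end;
both lie in `S`, which is closed under parents. -/
theorem mem_of_dir_of_isChain {S : Set V}
    (hS : ∀ a b, G.dir a b → b ∈ S → a ∈ S) (l : List V) : ∀ a b : V, G.dir a b →
    (a :: b :: l).IsChain G.skeleton.Adj →
    (∀ A B C, [A, B, C] <:+: a :: b :: l → G.Collider A B C → B ∈ S) →
    (b :: l).getLast (by simp) ∈ S → b ∈ S := by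
  induction l with
  | nil => intro a b _ _ _ h; simpa using h
  | cons c l ih =>
    intro a b hab hch hcol hlast
    by_cases h : G.Into c b
    · exact hcol a b c ⟨[], l, rfl⟩ ⟨.inl hab, h⟩
    · have hch' := List.isChain_cons_cons.1 hch
      have hbc : G.dir b c :=
        (into_or_dir_of_adj (List.isChain_cons_cons.1 hch'.2).1.symm).resolve_left h
      refine hS b c hbc (ih b c hbc hch'.2 (fun A B C hi => hcol A B C (hi.trans ?_)) ?_)
      · exact (List.suffix_cons _ _).isInfix
      · simpa using hlast

theorem mem_of_isChain {S : Set V}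
    (hS : ∀ a b, G.dir a b → b ∈ S → a ∈ S) {l : List V} (hch : l.IsChain G.skeleton.Adj)
    (hcol : ∀ A B C, [A, B, C] <:+: l → G.Collider A B C → B ∈ S)
    (hhead : ∀ v ∈ l.head?, v ∈ S) (hlast : ∀ v ∈ l.getLast?, v ∈ S) {v : V} (hv : v ∈ l) :
    v ∈ S := by
  obtain ⟨l₁, l₂, rfl⟩ := List.append_of_mem hv
  rcases List.eq_nil_or_concat l₁ with rfl | ⟨l₁, a, rfl⟩
  · exact hhead v (by simp)
  rcases l₂ with _ | ⟨c, l₂⟩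
  · exact hlast v (by simp)
  have hi : [a, v, c] <:+: l₁.concat a ++ v :: c :: l₂ := ⟨l₁, l₂, by simp⟩
  by_cases hcl : G.Collider a v c
  · exact hcol a v c hi hcl
  have hch3 := hch.infix hi
  simp only [List.isChain_cons_cons, List.isChain_singleton, and_true] at hch3
  rw [Collider, not_and_or] at hcl
  rcases hcl with h | h
  · have hd := (into_or_dir_of_adj hch3.1).resolve_left h
    have hi' : l₁ ++ [a, v] <:+: l₁.concat a ++ v :: c :: l₂ := ⟨[], c :: l₂, by simp⟩
    have hrev : (l₁ ++ [a, v]).reverse = v :: a :: l₁.reverse := by simp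
    refine hS v a hd (mem_of_dir_of_isChain hS l₁.reverse v a hd ?_ ?_ ?_)
    · rw [← hrev, List.isChain_reverse]
      exact (hch.infix hi').imp fun _ _ h => h.symm
    · intro A B C hABC hc
      rw [← hrev] at hABC
      refine hcol C B A (List.IsInfix.trans ?_ hi') hc.symm
      rw [← List.reverse_infix]
      simpa using hABC
    · apply hhead
      rcases l₁ with _ | ⟨b, l₁⟩ <;> simp
  · have hd := (into_or_dir_of_adj hch3.2.symm).resolve_left h
    have hi' : v :: c :: l₂ <:+: l₁.concat a ++ v :: c :: l₂ := ⟨l₁.concat a, [], by simp⟩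
    refine hS v c hd (mem_of_dir_of_isChain hS l₂ v c hd (hch.infix hi')
      (fun A B C hABC => hcol A B C (hABC.trans hi')) (hlast _ ?_))
    simp [List.getLast?_eq_getLast_of_ne_nil]

theorem reachable_of_not_mSep (hG : G.IsAncestral) {x y : V} {Z : Set V} (hx : x ∉ Z)
    (hy : y ∉ Z) (h : ¬ G.MSep x y Z) :
    (G.connGraph (G.AncSet (Z ∪ {x, y})) Z).Reachable x y := by
  simp only [MSep, not_forall] at h
  obtain ⟨p, -, hp⟩ := h
  simp only [Blocked, not_exists, not_and, not_or, not_not] at hp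
  have hxS : x ∈ G.AncSet (Z ∪ {x, y}) := subset_ancSet _ (by simp)
  have hyS : y ∈ G.AncSet (Z ∪ {x, y}) := subset_ancSet _ (by simp)
  have hmem : ∀ v ∈ p.support, v ∈ G.AncSet (Z ∪ {x, y}) := fun v hv =>
    mem_of_isChain (fun a b => mem_ancSet_of_dir) p.isChain_adj_support
      (fun A B C hc hcol => (hp A B C hc).1 hcol)
      (fun v hv => by
        rw [← p.cons_tail_support] at hv
        simp only [List.head?_cons, Option.mem_some_iff] at hv
        exact hv ▸ hxS)
      (fun v hv => by
        rw [List.getLast?_eq_getLast_of_ne_nil p.support_ne_nil, p.getLast_support] at hv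
        simp only [Option.mem_some_iff] at hv
        exact hv ▸ hyS) hv
  have hnon : ∀ A B C, Consec p A B C → ¬ G.Collider A B C → B ∉ Z := fun A B C hc =>
    (hp A B C hc).2
  have hch : p.support.IsChain (G.connGraph (G.AncSet (Z ∪ {x, y})) Z).Adj := by
    rw [List.isChain_iff_forall_rel_of_append_cons_cons]
    intro b c l₁ l₂ hl
    have hadj := List.isChain_iff_forall_rel_of_append_cons_cons.1 p.isChain_adj_support hl
    refine ⟨hadj, ⟨hmem b (by simp [hl]), hmem c (by simp [hl])⟩, fun hd => ?_, fun hd => ?_⟩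
    · rcases List.eq_nil_or_concat l₁ with rfl | ⟨l₁, a, rfl⟩
      · rw [← p.cons_tail_support] at hl
        simp only [List.nil_append, List.cons.injEq] at hl
        exact hl.1 ▸ hx
      · exact hnon a b c ⟨l₁, l₂, by simp [hl]⟩ fun hcol => hG.not_dir_of_into hcol.2 hd
    · rcases l₂ with _ | ⟨d, l₂⟩
      · have := p.getLast_support
        simp only [hl, List.getLast_append_of_ne_nil, ne_eq, reduceCtorEq, not_false_eq_true,
          List.getLast_cons_cons, List.getLast_singleton] at this
        exact this ▸ hy
      · exact hnon b c d ⟨l₁, l₂, by simp [hl]⟩ fun hcol => hG.not_dir_of_into hcol.1 hd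
  have := List.relationReflTransGen_of_exists_isChain p.support hch p.support_ne_nil
  rwa [p.head_support, p.getLast_support, ← SimpleGraph.reachable_iff_reflTransGen] at this

/-! ### Shielded vertices are removable -/

/-- The interior vertices of collider paths from `X`, all of them parents of `W`. -/
inductive ParentDistrict (G : MixedGraph V) (X W : V) : V → Prop
  | base {v : V} : G.Into X v → G.dir v W → ParentDistrict G X W v
  | step {u v : V} : ParentDistrict G X W u → G.bidir u v → G.dir v W → ParentDistrict G X W v

theorem ParentDistrict.dir {X W v : V} (h : G.ParentDistrict X W v) : G.dir v W := by
  cases h <;> assumption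

/-- Whenever `X` and the interior vertices of a collider path from `X` to `u` are parents of `W`,
the vertices `u` and `W` are neighbors. -/
def Shielded (G : MixedGraph V) (X : V) : Prop :=
  ∀ W, G.dir X W → ∀ u, u ≠ W →
    (G.skeleton.Adj X u ∨ ∃ v, G.ParentDistrict X W v ∧ G.Into u v) → G.skeleton.Adj u W

theorem Shielded.dir_of_dir_of_dir {X : V} (hX : G.Shielded X) (hG : G.IsAncestral) {a b : V}
    (ha : G.dir a X) (hb : G.dir X b) : G.dir a b := by
  refine dir_of_adj_of_anc hG (hX b hb a ?_ (.inl (hG.adj_of_into (.inl ha)).symm))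
    (.head ha (.single hb))
  rintro rfl
  exact hG.not_dir_of_into (.inl ha) hb

/-- A directed path `a → X → b` is shortcut by `a → b`; the clause for `u = X` carries the induction
past `X`. -/
theorem Shielded.anc_induce {X : V} (hX : G.Shielded X) (hG : G.IsAncestral)
    (t : ({X}ᶜ : Set V)) {u : V} (h : Relation.ReflTransGen G.dir u t) :
    (∀ hu : u ≠ X, Relation.ReflTransGen (G.induce {X}ᶜ).dir ⟨u, hu⟩ t) ∧
    (u = X → ∃ w : ({X}ᶜ : Set V), G.dir X w ∧ Relation.ReflTransGen (G.induce {X}ᶜ).dir w t) := by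
  induction h using Relation.ReflTransGen.head_induction_on with
  | refl => exact ⟨fun _ => .refl, fun h => (t.2 h).elim⟩
  | @head a b hab _ ih =>
    by_cases hb : b = X
    · subst hb
      refine ⟨fun ha => ?_, fun ha => ?_⟩
      · obtain ⟨w, hw, hwt⟩ := ih.2 rfl
        exact .head (b := w) (hX.dir_of_dir_of_dir hG hab hw) hwt
      · exact (hG.not_anc_of_into (.inl hab) (ha ▸ .refl)).elim
    · refine ⟨fun ha => .head (show (G.induce {X}ᶜ).dir ⟨a, ha⟩ ⟨b, hb⟩ from hab) (ih.1 hb),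
        fun ha => ?_⟩
      subst ha
      exact ⟨⟨b, hb⟩, hab, ih.1 hb⟩

theorem exists_last_child [Finite V] (hG : G.IsAncestral) {X : V} {S : Set V}
    (h : ∃ w, G.dir X w ∧ w ∈ S) :
    ∃ w, G.dir X w ∧ w ∈ S ∧ ∀ u ∈ S, G.dir X u → ¬ G.dir w u := by
  let r : V → V → Prop := fun a b => Relation.TransGen G.dir b a
  have : IsTrans V r := ⟨fun _ _ _ h₁ h₂ => h₂.trans h₁⟩
  have : Std.Irrefl r := ⟨fun a ha => by
    obtain ⟨b, hab, hba⟩ := Relation.TransGen.head'_iff.1 ha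
    exact hG.1 ⟨a, b, hab, hba⟩⟩
  have hwf : WellFounded r := Finite.wellFounded_of_trans_of_irrefl r
  obtain ⟨w, hw, hmin⟩ := hwf.has_min {w | G.dir X w ∧ w ∈ S} h
  exact ⟨w, hw.1, hw.2, fun u hu hXu hd => hmin u ⟨hXu, hu⟩ (.single hd)⟩

theorem reachable_induce_or (H : SimpleGraph V) {X : V} (x : ({X}ᶜ : Set V)) {y : V}
    (h : H.Reachable x y) :
    (∃ hy : y ≠ X, (H.induce {X}ᶜ).Reachable x ⟨y, hy⟩) ∨
      ∃ u : ({X}ᶜ : Set V), H.Adj X u ∧ (H.induce {X}ᶜ).Reachable u x := by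
  rw [SimpleGraph.reachable_iff_reflTransGen] at h
  induction h with
  | refl => exact .inl ⟨x.2, .refl _⟩
  | @tail b c _ hbc ih =>
    rcases ih with ⟨hb, hxb⟩ | h
    · by_cases hc : c = X
      · exact .inr ⟨⟨b, hb⟩, hc ▸ hbc.symm, hxb.symm⟩
      · refine .inl ⟨hc, hxb.trans (SimpleGraph.Adj.reachable ?_)⟩
        exact hbc
    · exact .inr h

/-- An edge `W → u` would make `u` a later child of `X` in `S`, or close a directed or almost
directed cycle through `v → W → u`. -/
theorem Shielded.eq_or_into {X : V} (hX : G.Shielded X) (hG : G.IsAncestral) {S : Set V} {W u : V}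
    (hXW : G.dir X W) (hmax : ∀ u ∈ S, G.dir X u → ¬ G.dir W u) (hu : u ∈ S)
    (h : G.skeleton.Adj X u ∨ ∃ v, G.ParentDistrict X W v ∧ G.Into u v) :
    u = W ∨ G.Into u W := by
  by_cases huW : u = W
  · exact .inl huW
  refine .inr ((into_or_dir_of_adj (hX W hXW u huW h)).resolve_right fun hWu => ?_)
  rcases h with h | ⟨v, hv, huv⟩
  · exact hmax u hu (dir_of_adj_of_anc hG h (.head hXW (.single hWu))) hWu
  · exact hG.not_anc_of_into huv (.head hv.dir (.single hWu))

theorem Shielded.reachable_child {X : V} (hX : G.Shielded X) (hG : G.IsAncestral) {S N : Set V}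
    (W x : ({X}ᶜ : Set V)) (hXW : G.dir X W) (hW : (W : V) ∈ S)
    (hmax : ∀ u ∈ S, G.dir X u → ¬ G.dir W u) (hx : (x : V) ∉ N) {u : ({X}ᶜ : Set V)}
    (hux : ((G.connGraph S N).induce {X}ᶜ).Reachable u x)
    (hu : (G.connGraph S N).Adj X u ∨
      ∃ v, G.ParentDistrict X W v ∧ (G.connGraph S N).Adj v u ∧ G.Into u v) :
    ((G.connGraph S N).induce {X}ᶜ).Reachable W x := by
  have hstep : ∀ u : ({X}ᶜ : Set V), ((G.connGraph S N).Adj X u ∨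
      ∃ v, G.ParentDistrict X W v ∧ (G.connGraph S N).Adj v u ∧ G.Into u v) →
      ((u : V) ∈ N → ¬ G.dir u W) → ((G.connGraph S N).induce {X}ᶜ).Reachable W u := by
    intro u hu hN
    have huS : (u : V) ∈ S := by
      rcases hu with h | ⟨v, -, h, -⟩ <;> exact h.2.1.2
    rcases hX.eq_or_into hG hXW hmax huS (hu.imp (fun h => h.1)
      fun ⟨v, hv, _, h⟩ => ⟨v, hv, h⟩) with h | h
    · rw [Subtype.ext h]
    · refine (SimpleGraph.Adj.reachable ?_).symm
      change (G.connGraph S N).Adj u W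
      exact ⟨hG.adj_of_into h, ⟨huS, hW⟩, fun hd hn => hN hn hd,
        fun hd => (hG.not_dir_of_into h hd).elim⟩
  rw [SimpleGraph.reachable_iff_reflTransGen] at hux
  induction hux using Relation.ReflTransGen.head_induction_on with
  | refl => exact hstep x hu fun h => (hx h).elim
  | @head u u' huu' hu'x ih =>
    by_cases hN : (u : V) ∈ N → ¬ G.dir u W
    · rw [← SimpleGraph.reachable_iff_reflTransGen] at hu'x
      exact (hstep u hu hN).trans (huu'.reachable.trans hu'x)
    -- Here `u` is in `N` and a parent of `W`, so it cannot link to `W`. Being in `N` it has only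
    -- arrowheads on the walk, hence joins the parent district, and the next vertex takes its role.
    -- This stops by `x`, which is outside `N`.
    · push Not at hN
      have hadj : (G.connGraph S N).Adj u u' := huu'
      refine ih (.inr ⟨u, ?_, hadj, connGraph_into_of_adj hadj.symm hN.1⟩)
      rcases hu with h | ⟨v, hv, hvu, huv⟩
      · exact .base (connGraph_into_of_adj h hN.1) hN.2
      · exact .step hv (hG.bidir_of_into_of_into (connGraph_into_of_adj hvu hN.1) huv) hN.2

theorem Shielded.reachable_induce [Finite V] {X : V} (hX : G.Shielded X) (hG : G.IsAncestral)
    {S N : Set V} (hS : X ∈ S → ∃ w, G.dir X w ∧ w ∈ S) {x y : ({X}ᶜ : Set V)}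
    (hx : (x : V) ∉ N) (hy : (y : V) ∉ N) (h : (G.connGraph S N).Reachable x y) :
    ((G.connGraph S N).induce {X}ᶜ).Reachable x y := by
  rcases reachable_induce_or _ x h with ⟨_, h'⟩ | ⟨u, hXu, hux⟩
  · exact h'
  rcases reachable_induce_or _ y h.symm with ⟨_, h'⟩ | ⟨v, hXv, hvy⟩
  · exact h'.symm
  obtain ⟨W, hXW, hW, hmax⟩ := exists_last_child hG (hS hXu.2.1.1)
  have hWX : W ≠ X := (hG.adj_of_into (.inl hXW)).ne'
  exact (hX.reachable_child hG ⟨W, hWX⟩ x hXW hW hmax hx hux (.inl hXu)).symm.trans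
    (hX.reachable_child hG ⟨W, hWX⟩ y hXW hW hmax hy hvy (.inl hXv))

/-- A connecting path avoiding `X` stays connecting in `G`, whether or not `X` is added to the
conditioning set. -/
theorem mSep_induce_of_mSep (X : V) (hG : G.IsAncestral) {Y T : ({X}ᶜ : Set V)}
    {Z : Set ({X}ᶜ : Set V)} (hY : Y ∉ Z) (hT : T ∉ Z) {M : Set V} (hM : Subtype.val '' Z ⊆ M)
    (hM' : ∀ v : ({X}ᶜ : Set V), (v : V) ∈ M → v ∈ Z) (h : G.MSep Y T M) :
    (G.induce {X}ᶜ).MSep Y T Z := by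
  have hanc : ∀ {a b : ({X}ᶜ : Set V)}, Relation.ReflTransGen (G.induce {X}ᶜ).dir a b →
      Relation.ReflTransGen G.dir a b := fun {a b} h =>
    Relation.ReflTransGen.lift (r := (G.induce {X}ᶜ).dir) (p := G.dir) Subtype.val
      (fun _ _ h => h) a b h
  have hG' : (G.induce {X}ᶜ).IsAncestral :=
    ⟨fun ⟨a, b, hab, hba⟩ => hG.1 ⟨a, b, hab, hanc hba⟩,
      fun ⟨a, b, hab, hba⟩ => hG.2 ⟨a, b, hab, hanc hba⟩⟩
  by_contra hcon
  refine not_mSep_of_reachable ?_ h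
  refine (reachable_of_not_mSep hG' hY hT hcon).map (⟨Subtype.val, fun {a b} hab => ?_⟩ :
    (G.induce {X}ᶜ).connGraph ((G.induce {X}ᶜ).AncSet (Z ∪ {Y, T})) Z →g
      G.connGraph (G.AncSet (M ∪ {(Y : V), (T : V)})) M)
  have hmem : ∀ c : ({X}ᶜ : Set V), c ∈ (G.induce {X}ᶜ).AncSet (Z ∪ {Y, T}) →
      (c : V) ∈ G.AncSet (M ∪ {(Y : V), (T : V)}) := by
    intro c hc
    obtain ⟨s, hs, hcs⟩ := mem_ancSet.1 hc
    refine mem_ancSet.2 ⟨s, ?_, hanc hcs⟩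
    rcases hs with hs | rfl | rfl
    · exact .inl (hM ⟨s, hs, rfl⟩)
    · simp
    · simp
  exact ⟨⟨fun h => hab.1.1 (Subtype.ext h), hab.1.2⟩, ⟨hmem a hab.2.1.1, hmem b hab.2.1.2⟩,
    fun hd hn => hab.2.2.1 hd (hM' a hn), fun hd hn => hab.2.2.2 hd (hM' b hn)⟩

theorem Shielded.isRemovable [Finite V] {X : V} (hX : G.Shielded X) (hG : G.IsAncestral) :
    G.IsRemovable X := by
  intro Y T _ Z hY hT
  refine ⟨mSep_induce_of_mSep X hG hY hT subset_rfl fun v ⟨w, hw, hwv⟩ => Subtype.ext hwv ▸ hw,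
    fun h => ?_⟩
  by_contra hcon
  have hval : ∀ v : ({X}ᶜ : Set V), (v : V) ∈ Subtype.val '' Z ↔ v ∈ Z := fun v =>
    Subtype.val_injective.mem_set_image
  have hreach := reachable_of_not_mSep hG (mt (hval Y).1 hY) (mt (hval T).1 hT) hcon
  have hsub : ∀ s ∈ Subtype.val '' Z ∪ {(Y : V), (T : V)}, ∃ t : ({X}ᶜ : Set V),
      t ∈ Z ∪ {Y, T} ∧ s = t := by
    rintro s (⟨t, ht, rfl⟩ | rfl | rfl)
    · exact ⟨t, .inl ht, rfl⟩
    · exact ⟨Y, by simp, rfl⟩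
    · exact ⟨T, by simp, rfl⟩
  refine not_mSep_of_reachable ((hX.reachable_induce hG ?_ (mt (hval Y).1 hY)
    (mt (hval T).1 hT) hreach).mono ?_) h
  · intro hXS
    obtain ⟨s, hs, hXs⟩ := mem_ancSet.1 hXS
    obtain ⟨t, -, rfl⟩ := hsub s hs
    rcases hXs.cases_head with h | ⟨w, hXw, hwt⟩
    · exact (t.2 h.symm).elim
    · exact ⟨w, hXw, mem_ancSet.2 ⟨t, hs, hwt⟩⟩
  · intro a b hab
    have hmem : ∀ c : ({X}ᶜ : Set V),
        (c : V) ∈ G.AncSet (Subtype.val '' Z ∪ {(Y : V), (T : V)}) →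
        c ∈ (G.induce {X}ᶜ).AncSet (Z ∪ {Y, T}) := by
      intro c hc
      obtain ⟨s, hs, hcs⟩ := mem_ancSet.1 hc
      obtain ⟨t, ht, rfl⟩ := hsub s hs
      exact mem_ancSet.2 ⟨t, ht, (hX.anc_induce hG t hcs).1 c.2⟩
    have hab' : (G.connGraph (G.AncSet (Subtype.val '' Z ∪ {(Y : V), (T : V)}))
      (Subtype.val '' Z)).Adj a b := hab
    exact ⟨⟨hab.ne, hab'.1.2⟩, ⟨hmem a hab'.2.1.1, hmem b hab'.2.1.2⟩,
      fun hd hn => hab'.2.2.1 hd ((hval a).2 hn), fun hd hn => hab'.2.2.2 hd ((hval b).2 hn)⟩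

/-! ### The two conditions force shieldedness -/

theorem mem_mb_of_reachable {X Y : V} (hYX : Y ≠ X)
    (h : (G.connGraph Set.univ {Y, X}ᶜ).Reachable Y X) : Y ∈ G.Mb X := by
  obtain ⟨p, hp, hpo⟩ := exists_isPath_of_reachable h
  refine ⟨hYX, p, hp, fun A B C hc => ?_⟩
  by_contra hcol
  obtain ⟨l₁, l₂, hl⟩ := hc
  have hnd := hp.support_nodup
  have hB := (hpo A B C ⟨l₁, l₂, hl⟩).2 hcol
  simp only [Set.mem_compl_iff, Set.mem_insert_iff, Set.mem_singleton_iff, not_not] at hB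
  rcases hB with rfl | rfl
  · have hl' := p.cons_tail_support
    rw [← hl] at hl' hnd
    rcases l₁ with _ | ⟨a, l₁⟩
    · simp only [List.nil_append, List.cons_append, List.cons.injEq] at hl'
      simp [hl'.1] at hnd
    · simp only [List.cons_append, List.cons.injEq] at hl'
      simp [hl'.1] at hnd
  · have hl' := List.dropLast_concat_getLast p.support_ne_nil
    rw [p.getLast_support, ← hl] at hl'
    rw [← hl] at hnd
    rcases List.eq_nil_or_concat l₂ with rfl | ⟨l₂, c, rfl⟩
    · have hC := (List.append_inj' (hl'.trans (by simp : _ = (l₁ ++ [A, B]) ++ [C])) rfl).2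
      simp only [List.cons.injEq, and_true] at hC
      simp [hC, List.nodup_append] at hnd
    · have hc := (List.append_inj' (hl'.trans
        (by simp : _ = (l₁ ++ [A, B, C] ++ l₂) ++ [c])) rfl).2
      simp only [List.cons.injEq, and_true] at hc
      simp [hc, List.nodup_append] at hnd

theorem mem_mb_of_bidir_chain (hG : G.IsAncestral) {X Y c w : V} (hYX : Y ≠ X) (hc : G.Into X c)
    (hcw : Relation.ReflTransGen G.bidir c w) (hw : Y = w ∨ G.Into Y w) : Y ∈ G.Mb X := by
  refine mem_mb_of_reachable hYX ?_
  have hXc : (G.connGraph Set.univ {Y, X}ᶜ).Adj X c :=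
    connGraph_adj_of_into hG hc trivial trivial (by simp)
  have hcw' := (connGraph_reachable_of_bidir_chain hG (S := Set.univ) (N := {Y, X}ᶜ) trivial
    (Relation.ReflTransGen.mono (fun _ _ h => ⟨h, trivial⟩) _ _ hcw)).2
  refine SimpleGraph.Reachable.trans ?_ (hXc.reachable.trans hcw').symm
  rcases hw with rfl | hw
  · exact .refl _
  · exact (connGraph_adj_of_into hG hw (Set.mem_univ _) (Set.mem_univ _) (by simp)).reachable

theorem ParentDistrict.exists_chain {X W v : V} (h : G.ParentDistrict X W v) :
    ∃ c, G.Into X c ∧ Relation.ReflTransGen G.bidir c v := by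
  induction h with
  | base h _ => exact ⟨_, h, .refl⟩
  | step _ h _ ih =>
    obtain ⟨c, hc, hcv⟩ := ih
    exact ⟨c, hc, hcv.tail h⟩

/-- The chain and the edge from `u` form an inducing path: its inner vertices are colliders in
`AncSet {u, C}`, so no set blocks it. -/
theorem IsMAG.adj_of_inducing (hG : G.IsMAG) {u C w : V} (huC : u ≠ C)
    (hw : Relation.ReflTransGen (fun a b => G.bidir a b ∧ b ∈ G.AncSet {u, C}) C w)
    (huw : G.Into u w) : G.skeleton.Adj u C := by
  by_contra hadj
  obtain ⟨Z, hu, hC, hsep⟩ := hG.2 u C huC hadj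
  refine not_mSep_of_reachable ?_ hsep
  have hS : G.AncSet {u, C} ⊆ G.AncSet (Z ∪ {u, C}) := ancSet_mono Set.subset_union_right
  obtain ⟨hwS, hCw⟩ := connGraph_reachable_of_bidir_chain hG.1 (N := Z)
    (hS (subset_ancSet _ (by simp))) (Relation.ReflTransGen.mono (fun _ _ h => ⟨h.1, hS h.2⟩) _ _ hw)
  exact (connGraph_adj_of_into hG.1 huw (hS (subset_ancSet _ (by simp))) hwS hu).reachable.trans
    hCw.symm

/-- A walk from `C` can only use bidirected edges: `C` has no child in the ancestor set, and each
further vertex before `u` is `X` or in its boundary, so it has no tail. Reaching `u` would give an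
inducing path. -/
theorem IsMAG.not_reachable_mb (hG : G.IsMAG) {X u C : V} (hXC : G.dir X C) (huC : u ≠ C)
    (hadj : ¬ G.skeleton.Adj u C) (hanc : ¬ Relation.ReflTransGen G.dir C u) :
    ¬ (G.connGraph (G.AncSet {u, C})
      ((G.Mb X ∩ G.AncSet {u, C}) \ {u, C} ∪ {X})).Reachable C u := by
  set S := G.AncSet {u, C} with hS
  set N := (G.Mb X ∩ S) \ {u, C} ∪ {X} with hN
  intro h
  have hCout : ∀ c, c ∈ S → ¬ G.dir C c := by
    intro c hc hd
    obtain ⟨s, hs, hcs⟩ := mem_ancSet.1 hc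
    rcases hs with rfl | rfl
    · exact hanc (.head hd hcs)
    · exact hG.1.not_anc_of_into (.inl hd) hcs
  have hMbN : ∀ v, v ∈ S → v ≠ u → v ≠ C → (v ≠ X → v ∈ G.Mb X) → v ∈ N := by
    intro v hvS hvu hvC hv
    by_cases hvX : v = X
    · exact .inr hvX
    · exact .inl ⟨⟨hv hvX, hvS⟩, by simp [hvu, hvC]⟩
  suffices ∀ w, Relation.ReflTransGen (G.connGraph S N).Adj C w →
      w ≠ u ∧ Relation.ReflTransGen (fun a b => G.bidir a b ∧ b ∈ S) C w from
    (this u ((SimpleGraph.reachable_iff_reflTransGen _ _).1 h)).1 rfl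
  intro w hw
  induction hw with
  | refl => exact ⟨huC.symm, .refl⟩
  | @tail w w' _ hww' ih =>
    obtain ⟨hwu, hchain⟩ := ih
    have hbid : Relation.ReflTransGen G.bidir C w :=
      Relation.ReflTransGen.mono (fun _ _ h => h.1) _ _ hchain
    have hdir : ¬ G.dir w w' := by
      intro hd
      by_cases hwC : w = C
      · exact hCout w' hww'.2.1.2 (hwC ▸ hd)
      · exact hww'.2.2.1 hd (hMbN w hww'.2.1.1 hwu hwC fun hwX =>
          mem_mb_of_bidir_chain hG.1 hwX (.inl hXC) hbid (.inl rfl))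
    have hinto : G.Into w' w := (into_or_dir_of_adj hww'.1.symm).resolve_right hdir
    have hw'u : w' ≠ u := by
      rintro rfl
      exact hadj (hG.adj_of_inducing huC hchain hinto)
    have hdir' : ¬ G.dir w' w := by
      intro hd
      refine hww'.2.2.2 hd (hMbN w' hww'.2.1.2 hw'u ?_ fun hwX =>
        mem_mb_of_bidir_chain hG.1 hwX (.inl hXC) hbid (.inr hinto))
      rintro rfl
      exact hCout w hww'.2.1.1 hd
    exact ⟨hw'u, hchain.tail ⟨G.bidir_symm _ _ (hinto.resolve_left hdir'), hww'.2.1.2⟩⟩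

/-- The connection ends with `X → C`, where `X` is outside `W`; district vertices are colliders and
ancestors of `C`. -/
theorem reachable_of_parentDistrict (hG : G.IsAncestral) {X C u : V} {W : Set V}
    (hXC : G.dir X C) (hX : X ∉ W) (hu : u ∉ W)
    (h : G.skeleton.Adj X u ∨ ∃ v, G.ParentDistrict X C v ∧ G.Into u v) :
    (G.connGraph (G.AncSet (W ∪ {u, C})) W).Reachable u C := by
  set S := G.AncSet (W ∪ {u, C})
  have hCS : C ∈ S := subset_ancSet _ (by simp)
  have huS : u ∈ S := subset_ancSet _ (by simp)
  have hXS : X ∈ S := mem_ancSet_of_dir hXC hCS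
  refine SimpleGraph.Reachable.trans ?_ (connGraph_adj_of_dir hG hXC hXS hCS hX).reachable
  rcases h with h | ⟨v, hv, huv⟩
  · refine SimpleGraph.Adj.reachable ?_
    exact ⟨h.symm, ⟨huS, hXS⟩, fun _ => hu, fun _ => hX⟩
  · have hvS : v ∈ S := mem_ancSet_of_dir hv.dir hCS
    refine (connGraph_adj_of_into hG huv huS hvS hu).reachable.trans (SimpleGraph.Reachable.symm ?_)
    clear huv hvS
    induction hv with
    | base h hd => exact (connGraph_adj_of_into hG h hXS (mem_ancSet_of_dir hd hCS) hX).reachable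
    | step hw hb hd ih =>
      exact ih.trans (connGraph_adj_of_bidir hG hb (mem_ancSet_of_dir hw.dir hCS)
        (mem_ancSet_of_dir hd hCS)).reachable

theorem IsMAG.shielded (hG : G.IsMAG) {X : V}
    (h : ∀ Y ∈ G.Mb X, ∀ Z ∈ G.Ne X \ {Y},
        (∃ W : Set V, W ⊆ G.Mb X \ {Y, Z} ∧ G.MSep Y Z W) ∨
        (∀ W : Set V, W ⊆ G.Mb X \ {Y, Z} → ¬ G.MSep Y Z (W ∪ {X}))) : G.Shielded X := by
  intro C hXC u huC hu
  by_cases huX : u = X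
  · exact huX ▸ hG.1.adj_of_into (.inl hXC)
  by_contra hadj
  have hXM : X ∉ G.Mb X := fun h => h.1 rfl
  have huM : u ∈ G.Mb X := by
    rcases hu with hXu | ⟨v, hv, huv⟩
    · refine mem_mb_of_reachable huX (SimpleGraph.Adj.reachable ?_)
      exact ⟨hXu.symm, ⟨trivial, trivial⟩, fun _ => by simp, fun _ => by simp⟩
    · obtain ⟨c, hc, hcv⟩ := hv.exists_chain
      exact mem_mb_of_bidir_chain hG.1 huX hc hcv (.inr huv)
  have hCX : C ≠ X := (hG.1.adj_of_into (.inl hXC)).ne'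
  have hCN : C ∈ G.Ne X \ {u} := ⟨hG.1.adj_of_into (.inl hXC), huC.symm⟩
  rcases h u huM C hCN with ⟨W, hW, hsep⟩ | hcon
  · exact not_mSep_of_reachable (reachable_of_parentDistrict hG.1 hXC (fun h => hXM (hW h).1)
      (fun h => (hW h).2 (by simp)) hu) hsep
  · have hXS : X ∈ G.AncSet {u, C} := mem_ancSet_of_dir hXC (subset_ancSet _ (by simp))
    have hreach := reachable_of_not_mSep hG.1 (by simp [huX]) (by simp [hCX])
      (hcon ((G.Mb X ∩ G.AncSet {u, C}) \ {u, C}) fun v hv => ⟨hv.1.1, hv.2⟩)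
    have hS : G.AncSet ((G.Mb X ∩ G.AncSet {u, C}) \ {u, C} ∪ {X} ∪ {u, C}) =
        G.AncSet {u, C} := by
      refine (ancSet_subset_ancSet ?_).antisymm (ancSet_mono Set.subset_union_right)
      rintro v ((hv | rfl) | hv)
      · exact hv.1.2
      · exact hXS
      · exact subset_ancSet _ hv
    rw [hS] at hreach
    -- If `C` is an ancestor of `u`, then `u` is itself a child of `X` and the roles of `u` and `C`
    -- are exchanged.
    by_cases hanc : Relation.ReflTransGen G.dir C u
    · have hXu : G.dir X u := by
        rcases hu with hXu | ⟨v, hv, huv⟩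
        · exact dir_of_adj_of_anc hG.1 hXu (.head hXC hanc)
        · exact (hG.1.not_anc_of_into huv (.head hv.dir hanc)).elim
      have hanc' : ¬ Relation.ReflTransGen G.dir u C := fun h => by
        rcases hanc.cases_head with h' | ⟨c, hc, hcu⟩
        · exact huC h'.symm
        · exact hG.1.not_anc_of_into (.inl hc) (hcu.trans h)
      refine hG.not_reachable_mb hXu huC.symm (fun h => hadj h.symm) hanc' ?_
      rwa [Set.pair_comm]
    · exact hG.not_reachable_mb hXC huC hadj hanc hreach.symm

end MixedGraph

theorem mainTheorem4 {V : Type*} [Finite V] (G : MixedGraph V) (hG : G.IsMAG) (X : V) :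
    G.IsRemovable X ↔
      ∀ Y ∈ G.Mb X, ∀ Z ∈ G.Ne X \ {Y},
        (∃ W : Set V, W ⊆ G.Mb X \ {Y, Z} ∧ G.MSep Y Z W) ∨
        (∀ W : Set V, W ⊆ G.Mb X \ {Y, Z} → ¬ G.MSep Y Z (W ∪ {X})) := by
  refine ⟨fun hrem Y hY Z hZ => ?_, fun h => (hG.shielded h).isRemovable hG.1⟩
  refine or_iff_not_imp_right.2 fun hcon => ?_
  push Not at hcon
  obtain ⟨W, hW, hsep⟩ := hcon
  refine ⟨W, hW, ?_⟩
  have hval : Subtype.val '' (Subtype.val ⁻¹' W : Set ({X}ᶜ : Set V)) = W := by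
    rw [Subtype.image_preimage_coe]
    exact Set.inter_eq_right.2 fun v hv hvX => (hW hv).1.1 hvX
  have hYW : Y ∉ W := fun h => (hW h).2 (by simp)
  have hZW : Z ∉ W := fun h => (hW h).2 (by simp)
  have hmain := hrem ⟨Y, hY.1⟩ ⟨Z, hZ.1.1.symm⟩ (fun h => hZ.2 (Subtype.ext_iff.1 h).symm)
    (Subtype.val ⁻¹' W) hYW hZW
  rw [hval] at hmain
  refine hmain.2 (MixedGraph.mSep_induce_of_mSep X hG.1 hYW hZW (M := W ∪ {X}) ?_ ?_ hsep)
  · rw [hval]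
    exact Set.subset_union_left
  · rintro v (hv | hv)
    · exact hv
    · exact (v.2 hv).elim
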